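/- For $N\ge 1$, $\beta\ge 0$ and $m\in(-1,1)$ let $$Z_{N,\beta,m}=\sum_{\sigma\in\{-1,1\}^N}\Big(\prod_{i=1}^N\frac{1+m\sigma_i}{2}\Big)\exp\Big(\frac{\beta}{\sqrt2}\sum_{1\le i,j\le N}g_{ij}\widehat\sigma_i\widehat\sigma_j-\frac{\beta^2}{4N}\sum_{1\le i,j\le N}\widehat\sigma_i^2\widehat\sigma_j^2\Big),\qquad \widehat\sigma_i=\sigma_i-m,$$ where $(g_{ij})_{1\le i,j\le N}$ are i.i.d. centred Gaussian random variables with variance $1/N$. Define $$\mathrm{HT}_m=\Big\{\beta\ge0:\lim_{N\to\infty}\mathbb E\,\tfrac1N\log Z_{N,\beta,m}=0\Big\},\qquad \mathrm{AT}_m=\big\{\beta\ge0:\beta^2(1-m^2)^2\le1\big\},$$ $$I(m)=-\frac{1+m}{2}\log\frac{1+m}{2}-\frac{1-m}{2}\log\frac{1-m}{2}.$$ There is a unique $m_*\in(0,1)$ with $I(m_*)=\frac14$, and for every $m$ with $m_*<|m|<1$ there exists $\beta\in\mathrm{AT}_m$ with $\beta\notin\mathrm{HT}_m$, and in fact with $\limsup_{N\to\infty}\mathbb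 E\,\frac1N\log Z_{N,\beta,m}<0$; in particular $\mathrm{AT}_m\not\subset\mathrm{HT}_m$. More precisely, for every such $m$, every $\beta\ge0$ with $4I(m)<\beta^2(1-m^2)^2\le1$ satisfies $\beta\notin\mathrm{HT}_m$ and $\limsup_{N\to\infty}\mathbb E\,\frac1N\log Z_{N,\beta,m}<0$. -/

import Mathlib

open Filter Topology MeasureTheory ProbabilityTheory

noncomputable section

namespace ToySK

/-- The spin configurations `{-1, 1}^N`. -/
def configs (N : ℕ) : Finset (Fin N → ℝ) :=
  Fintype.piFinset fun _ => ({-1, 1} : Finset ℝ)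

/-- The product weight `p_m(σ) = ∏ i, (1 + m σ_i) / 2` of i.i.d. spins with mean `m`. -/
def weight (N : ℕ) (m : ℝ) (σ : Fin N → ℝ) : ℝ :=
  ∏ i, (1 / 2 : ℝ) * (1 + m * σ i)

/-- The Hamiltonian with quartic correction,
`∑ i j, (β / √2) g_ij (σ_i - m) (σ_j - m) - (β² / (4 N)) ∑ i j, (σ_i - m)² (σ_j - m)²`. -/
def hamiltonian (N : ℕ) (β m : ℝ) (g : Fin N × Fin N → ℝ) (σ : Fin N → ℝ) : ℝ :=
  (∑ i, ∑ j, β / √2 * g (i, j) * (σ i - m) * (σ j - m))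
    - β ^ 2 / (4 * (N : ℝ)) * ∑ i, ∑ j, (σ i - m) ^ 2 * (σ j - m) ^ 2

/-- The partition function `Z_{N,β,m}` as a function of the couplings. -/
def partitionFunction (N : ℕ) (β m : ℝ) (g : Fin N × Fin N → ℝ) : ℝ :=
  ∑ σ ∈ configs N, weight N m σ * Real.exp (hamiltonian N β m g σ)

/-- The law of the couplings `(g_ij)`: i.i.d. centred Gaussians of variance `1 / N`. -/
def couplingLaw (N : ℕ) : Measure (Fin N × Fin N → ℝ) :=
  Measure.pi fun _ => gaussianReal 0 ((N : NNReal)⁻¹)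

/-- The quenched free energy `E (1 / N) log Z_{N,β,m}`. -/
def freeEnergy (N : ℕ) (β m : ℝ) : ℝ :=
  ∫ g, 1 / (N : ℝ) * Real.log (partitionFunction N β m g) ∂(couplingLaw N)

/-- The high temperature set `HT_m`. -/
def HT (m : ℝ) : Set ℝ :=
  {β | 0 ≤ β ∧ Tendsto (fun N : ℕ => freeEnergy N β m) atTop (𝓝 0)}

/-- The de Almeida-Thouless type region `AT_m`. -/
def AT (m : ℝ) : Set ℝ :=
  {β | 0 ≤ β ∧ β ^ 2 * (1 - m ^ 2) ^ 2 ≤ 1}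

/-- The binary entropy (natural logarithm) of a `±1` spin with mean `m`. -/
def spinEntropy (m : ℝ) : ℝ :=
  -((1 + m) / 2) * Real.log ((1 + m) / 2) - (1 - m) / 2 * Real.log ((1 - m) / 2)

end ToySK

end

/-! ### Entropy of a biased spin and the threshold `1 / 4`. -/

namespace ToySK

/-! Fractional moments. For `0 < s < 1`, subadditivity of `x ^ s` bounds `Z ^ s` by a sum over
configurations, whose Gaussian mean is explicit and depends on `σ` through `Q = ∑ i, (σ i - m) ^ 2`.
As `s ^ 2 - s ≤ 0`, replacing `Q ^ 2 / N` by its tangent at `Q = N * (1 - m ^ 2)` gives an upper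
bound that factorizes over sites: `integral_fractionalSum_le`. The site factor is `1` at `s = 1`,
with slope `β ^ 2 * (1 - m ^ 2) ^ 2 / 4 - spinEntropy m` (`hasDerivAt_siteMoment`). If this is
positive, the factor drops below `1` for some `s < 1`, and Jensen (`freeEnergy_le`) gives a negative
bound uniform in `N`. -/

lemma spinEntropy_eq_binEntropy (m : ℝ) : spinEntropy m = Real.binEntropy ((1 + m) / 2) := by
  rw [Real.binEntropy_eq_negMulLog_add_negMulLog_one_sub, Real.negMulLog, Real.negMulLog,
    spinEntropy, show 1 - (1 + m) / 2 = (1 - m) / 2 by ring]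
  ring

lemma spinEntropy_abs (m : ℝ) : spinEntropy |m| = spinEntropy m := by
  rcases abs_choice m with h | h <;> rw [h]
  simp only [spinEntropy]
  ring_nf

lemma spinEntropy_strictAntiOn : StrictAntiOn spinEntropy (Set.Icc 0 1) := by
  intro x hx y hy hxy
  rw [spinEntropy_eq_binEntropy, spinEntropy_eq_binEntropy]
  refine Real.binEntropy_strictAntiOn ⟨?_, ?_⟩ ⟨?_, ?_⟩ (by linarith) <;>
    linarith [hx.1, hx.2, hy.1, hy.2]

lemma existsUnique_spinEntropy_eq :
    ∃! m : ℝ, 0 < m ∧ m < 1 ∧ spinEntropy m = 1 / 4 := by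
  have hcont : Continuous spinEntropy := by
    rw [show spinEntropy = fun m => Real.binEntropy ((1 + m) / 2) from
      funext spinEntropy_eq_binEntropy]
    fun_prop
  have h0 : spinEntropy 0 = Real.log 2 := by simp [spinEntropy_eq_binEntropy]
  have h1 : spinEntropy 1 = 0 := by norm_num [spinEntropy]
  obtain ⟨m, hm, hm'⟩ := intermediate_value_Ioo' zero_le_one hcont.continuousOn
    (show (1 / 4 : ℝ) ∈ Set.Ioo (spinEntropy 1) (spinEntropy 0) by
      rw [h0, h1]; constructor <;> linarith [Real.log_two_gt_d9])
  refine ⟨m, ⟨hm.1, hm.2, hm'⟩, fun y hy => ?_⟩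
  exact spinEntropy_strictAntiOn.injOn ⟨hy.1.le, hy.2.1.le⟩ ⟨hm.1.le, hm.2.le⟩
    (hy.2.2.trans hm'.symm)

/-! ### The one-site moment near `s = 1`. -/

/-- The one-site factor bounding the moment of order `s` of the partition function. -/
noncomputable def siteMoment (β m s : ℝ) : ℝ :=
  ∑ x ∈ ({-1, 1} : Finset ℝ), (1 / 2 * (1 + m * x)) ^ s *
    Real.exp ((s ^ 2 - s) * β ^ 2 / 4 * (2 * (1 - m ^ 2) * (x - m) ^ 2 - (1 - m ^ 2) ^ 2))

lemma siteMoment_eq (β m s : ℝ) : siteMoment β m s =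
    (1 / 2 * (1 + m * -1)) ^ s * Real.exp ((s ^ 2 - s) * β ^ 2 / 4 *
      (2 * (1 - m ^ 2) * (-1 - m) ^ 2 - (1 - m ^ 2) ^ 2)) +
    (1 / 2 * (1 + m * 1)) ^ s * Real.exp ((s ^ 2 - s) * β ^ 2 / 4 *
      (2 * (1 - m ^ 2) * (1 - m) ^ 2 - (1 - m ^ 2) ^ 2)) := by
  rw [siteMoment, Finset.sum_pair (by norm_num)]

lemma spin_factor_pos {m x : ℝ} (hm : |m| < 1) (hx : x ∈ ({-1, 1} : Finset ℝ)) :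
    0 < 1 / 2 * (1 + m * x) := by
  have := abs_lt.1 hm
  simp only [Finset.mem_insert, Finset.mem_singleton] at hx
  rcases hx with rfl | rfl <;> linarith

lemma siteMoment_pos (β : ℝ) {m : ℝ} (hm : |m| < 1) (s : ℝ) : 0 < siteMoment β m s :=
  Finset.sum_pos (fun _ hx => mul_pos (Real.rpow_pos_of_pos (spin_factor_pos hm hx) _)
    (Real.exp_pos _)) ⟨1, by simp⟩

lemma siteMoment_one (β m : ℝ) : siteMoment β m 1 = 1 := by
  rw [siteMoment_eq]; simp; ring

/-- Differentiating the weights to the power `s` yields minus the entropy; the other term averages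
the tangent line, and `(x - m) ^ 2` has mean `1 - m ^ 2`. -/
lemma hasDerivAt_siteMoment (β : ℝ) {m : ℝ} (hm : |m| < 1) :
    HasDerivAt (siteMoment β m) (β ^ 2 * (1 - m ^ 2) ^ 2 / 4 - spinEntropy m) 1 := by
  have key : ∀ a b : ℝ, 0 < a →
      HasDerivAt (fun s : ℝ => a ^ s * Real.exp ((s ^ 2 - s) * β ^ 2 / 4 * b))
        (a * Real.log a + a * (β ^ 2 / 4 * b)) 1 := by
    intro a b ha
    have h1 := (hasDerivAt_id (1 : ℝ)).const_rpow ha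
    have h2 : HasDerivAt (fun s : ℝ => (s ^ 2 - s) * β ^ 2 / 4 * b) (β ^ 2 / 4 * b) 1 := by
      have := (((((hasDerivAt_id (1 : ℝ)).pow 2).sub (hasDerivAt_id (1 : ℝ))).mul_const
        (β ^ 2)).div_const 4).mul_const b
      convert! this using 1
      norm_num
    convert! h1.mul h2.exp using 1
    simp
    ring
  have := abs_lt.1 hm
  rw [show siteMoment β m = _ from funext (siteMoment_eq β m)]
  convert! (key (1 / 2 * (1 + m * -1)) _ (by linarith)).add
    (key (1 / 2 * (1 + m * 1)) _ (by linarith)) using 1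
  rw [spinEntropy, show 1 / 2 * (1 + m * -1) = (1 - m) / 2 by ring,
    show 1 / 2 * (1 + m * 1) = (1 + m) / 2 by ring]
  ring

lemma exists_siteMoment_lt_one {β m : ℝ} (hm : |m| < 1)
    (h : 4 * spinEntropy m < β ^ 2 * (1 - m ^ 2) ^ 2) :
    ∃ s : ℝ, 0 < s ∧ s < 1 ∧ siteMoment β m s < 1 := by
  have hd : 0 < β ^ 2 * (1 - m ^ 2) ^ 2 / 4 - spinEntropy m := by linarith
  have h1 := (hasDerivAt_iff_tendsto_slope.1 (hasDerivAt_siteMoment β hm)).eventually_const_lt hd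
  have h2 : ∀ᶠ s in 𝓝[<] (1 : ℝ), 0 < slope (siteMoment β m) 1 s :=
    h1.filter_mono (nhdsWithin_mono _ fun s hs => ne_of_lt hs)
  have h3 : ∀ᶠ s in 𝓝[<] (1 : ℝ), s ∈ Set.Ioo (0 : ℝ) 1 := Ioo_mem_nhdsLT zero_lt_one
  obtain ⟨s, hs, hs0, hs1⟩ := (h2.and h3).exists
  refine ⟨s, hs0, hs1, ?_⟩
  rw [slope_def_field, siteMoment_one] at hs
  by_contra! hc
  exact absurd hs (not_lt.2 (div_nonpos_of_nonneg_of_nonpos (by linarith) (by linarith)))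

lemma sum_rpow_le {ι : Type*} (t : Finset ι) {f : ι → ℝ} (hf : ∀ i ∈ t, 0 ≤ f i) {s : ℝ}
    (hs : 0 < s) (hs1 : s ≤ 1) : (∑ i ∈ t, f i) ^ s ≤ ∑ i ∈ t, f i ^ s :=
  Finset.le_sum_of_subadditive_on_pred (fun x : ℝ => x ^ s) (fun x => 0 ≤ x)
    (by simp [Real.zero_rpow hs.ne'])
    (fun _ _ hx hy => Real.rpow_add_le_add_rpow hx hy hs.le hs1)
    (fun _ _ hx hy => add_nonneg hx hy) f hf

instance (N : ℕ) : IsProbabilityMeasure (couplingLaw N) := by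
  unfold couplingLaw; infer_instance

/-! ### Gaussian integrals over the couplings. -/

section Gaussian

variable {N : ℕ}

lemma exp_linear_eq_prod (c g : Fin N × Fin N → ℝ) :
    Real.exp (∑ p, c p * g p) = ∏ p, Real.exp (c p * g p) := Real.exp_sum _ _

lemma integrable_exp_linear (c : Fin N × Fin N → ℝ) :
    Integrable (fun g => Real.exp (∑ p, c p * g p)) (couplingLaw N) := by
  simp only [exp_linear_eq_prod]
  exact Integrable.fintype_prod_dep (f := fun p x => Real.exp (c p * x))
    fun p => integrable_exp_mul_gaussianReal (c p)

lemma integral_exp_linear (c : Fin N × Fin N → ℝ) :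
    ∫ g, Real.exp (∑ p, c p * g p) ∂(couplingLaw N) =
      Real.exp ((∑ p, c p ^ 2) / (2 * N)) := by
  simp only [exp_linear_eq_prod, couplingLaw]
  rw [integral_fintype_prod_eq_prod (fun p x => Real.exp (c p * x)), Finset.sum_div, Real.exp_sum]
  refine Finset.prod_congr rfl fun p _ => ?_
  have := congrFun (mgf_id_gaussianReal (μ := 0) (v := (N : NNReal)⁻¹)) (c p)
  simp only [mgf, id] at this
  rw [this]
  congr 1
  push_cast
  ring

lemma integrable_linear (c : Fin N × Fin N → ℝ) :
    Integrable (fun g : Fin N × Fin N → ℝ => ∑ p, c p * g p) (couplingLaw N) := by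
  refine integrable_finsetSum _ fun p _ => Integrable.const_mul ?_ _
  have hid : Integrable (id : ℝ → ℝ) (gaussianReal 0 ((N : NNReal)⁻¹)) :=
    memLp_one_iff_integrable.1 (memLp_id_gaussianReal 1)
  exact integrable_comp_eval (μ := fun _ : Fin N × Fin N => gaussianReal 0 ((N : NNReal)⁻¹)) hid

lemma hamiltonian_eq (β m : ℝ) (g : Fin N × Fin N → ℝ) (σ : Fin N → ℝ) :
    hamiltonian N β m g σ =
      (∑ p : Fin N × Fin N, β / √2 * (σ p.1 - m) * (σ p.2 - m) * g p)
        - β ^ 2 / (4 * (N : ℝ)) * (∑ i, (σ i - m) ^ 2) ^ 2 := by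
  rw [hamiltonian, Fintype.sum_prod_type, sq (∑ i, (σ i - m) ^ 2), Finset.sum_mul_sum]
  congr 1
  exact Finset.sum_congr rfl fun i _ => Finset.sum_congr rfl fun j _ => by ring

lemma sum_sq_coupling_coeff (β m : ℝ) (σ : Fin N → ℝ) :
    ∑ p : Fin N × Fin N, (β / √2 * (σ p.1 - m) * (σ p.2 - m)) ^ 2 =
      β ^ 2 / 2 * (∑ i, (σ i - m) ^ 2) ^ 2 := by
  rw [Fintype.sum_prod_type, sq (∑ i, (σ i - m) ^ 2), Finset.sum_mul_sum, Finset.mul_sum]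
  refine Finset.sum_congr rfl fun i _ => ?_
  rw [Finset.mul_sum]
  refine Finset.sum_congr rfl fun j _ => ?_
  rw [mul_pow, mul_pow, div_pow, Real.sq_sqrt zero_le_two]
  ring

lemma exp_mul_hamiltonian (β m s : ℝ) (g : Fin N × Fin N → ℝ) (σ : Fin N → ℝ) :
    Real.exp (s * hamiltonian N β m g σ) =
      Real.exp (∑ p : Fin N × Fin N, s * (β / √2 * (σ p.1 - m) * (σ p.2 - m)) * g p) *
        Real.exp (-(s * (β ^ 2 / (4 * (N : ℝ)) * (∑ i, (σ i - m) ^ 2) ^ 2))) := by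
  rw [← Real.exp_add, hamiltonian_eq, mul_sub, Finset.mul_sum, sub_eq_add_neg]
  simp only [mul_assoc]

lemma integrable_exp_mul_hamiltonian (β m s : ℝ) (σ : Fin N → ℝ) :
    Integrable (fun g => Real.exp (s * hamiltonian N β m g σ)) (couplingLaw N) := by
  simp only [exp_mul_hamiltonian]
  exact (integrable_exp_linear _).mul_const _

lemma integral_exp_mul_hamiltonian (β m s : ℝ) (σ : Fin N → ℝ) :
    ∫ g, Real.exp (s * hamiltonian N β m g σ) ∂(couplingLaw N) =
      Real.exp ((s ^ 2 - s) * (β ^ 2 / (4 * (N : ℝ))) * (∑ i, (σ i - m) ^ 2) ^ 2) := by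
  simp only [exp_mul_hamiltonian]
  rw [integral_mul_const, integral_exp_linear, ← Real.exp_add]
  simp only [mul_pow s, ← Finset.mul_sum, sum_sq_coupling_coeff]
  congr 1
  ring

lemma integrable_hamiltonian (β m : ℝ) (σ : Fin N → ℝ) :
    Integrable (fun g => hamiltonian N β m g σ) (couplingLaw N) := by
  simp only [hamiltonian_eq]
  exact (integrable_linear _).sub (integrable_const _)

end Gaussian

/-! ### Fractional moments of the partition function. -/

section PartitionFunction

variable {N : ℕ}

lemma weight_pos {m : ℝ} (hm : |m| < 1) {σ : Fin N → ℝ} (hσ : σ ∈ configs N) :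
    0 < weight N m σ :=
  Finset.prod_pos fun i _ => spin_factor_pos hm (Fintype.mem_piFinset.1 hσ i)

lemma one_mem_configs : (fun _ => 1 : Fin N → ℝ) ∈ configs N := by
  simp [configs, Fintype.mem_piFinset]

lemma partitionFunction_pos (β : ℝ) {m : ℝ} (hm : |m| < 1) (g : Fin N × Fin N → ℝ) :
    0 < partitionFunction N β m g :=
  Finset.sum_pos (fun _ hσ => mul_pos (weight_pos hm hσ) (Real.exp_pos _)) ⟨_, one_mem_configs⟩

/-- The termwise upper bound for `Z ^ s` when `0 < s ≤ 1`. -/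
noncomputable def fractionalSum (N : ℕ) (β m s : ℝ) (g : Fin N × Fin N → ℝ) : ℝ :=
  ∑ σ ∈ configs N, weight N m σ ^ s * Real.exp (s * hamiltonian N β m g σ)

lemma partitionFunction_rpow_le (β : ℝ) {m s : ℝ} (hm : |m| < 1) (hs : 0 < s) (hs1 : s ≤ 1)
    (g : Fin N × Fin N → ℝ) :
    partitionFunction N β m g ^ s ≤ fractionalSum N β m s g := by
  refine (sum_rpow_le _ (fun σ hσ => (mul_pos (weight_pos hm hσ) (Real.exp_pos _)).le)
    hs hs1).trans_eq (Finset.sum_congr rfl fun σ hσ => ?_)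
  rw [Real.mul_rpow (weight_pos hm hσ).le (Real.exp_pos _).le, ← Real.exp_mul, mul_comm s]

lemma integrable_fractionalSum (β m s : ℝ) :
    Integrable (fractionalSum N β m s) (couplingLaw N) :=
  integrable_finsetSum _ fun _ _ => (integrable_exp_mul_hamiltonian β m s _).const_mul _

lemma integral_fractionalSum_le (hN : 0 < N) (β : ℝ) {m s : ℝ} (hm : |m| < 1) (hs : 0 < s)
    (hs1 : s ≤ 1) :
    ∫ g, fractionalSum N β m s g ∂(couplingLaw N) ≤ siteMoment β m s ^ N := by
  have hN' : (0 : ℝ) < N := Nat.cast_pos.2 hN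
  have hprod : siteMoment β m s ^ N = ∑ σ ∈ configs N, ∏ i, ((1 / 2 * (1 + m * σ i)) ^ s *
      Real.exp ((s ^ 2 - s) * β ^ 2 / 4 *
        (2 * (1 - m ^ 2) * (σ i - m) ^ 2 - (1 - m ^ 2) ^ 2))) := by
    rw [configs, ← Finset.prod_univ_sum (fun _ : Fin N => ({-1, 1} : Finset ℝ))
      (fun _ x => (1 / 2 * (1 + m * x)) ^ s * Real.exp ((s ^ 2 - s) * β ^ 2 / 4 *
        (2 * (1 - m ^ 2) * (x - m) ^ 2 - (1 - m ^ 2) ^ 2)))]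
    simp [siteMoment]
  unfold fractionalSum
  rw [hprod, integral_finsetSum _ fun _ _ =>
    (integrable_exp_mul_hamiltonian β m s _).const_mul _]
  refine Finset.sum_le_sum fun σ hσ => ?_
  rw [integral_const_mul, integral_exp_mul_hamiltonian, Finset.prod_mul_distrib, weight,
    Real.finsetProd_rpow _ _
      fun i _ => (spin_factor_pos hm (Fintype.mem_piFinset.1 hσ i)).le, ← Real.exp_sum]
  refine mul_le_mul_of_nonneg_left (Real.exp_le_exp.2 ?_)
    (Real.rpow_nonneg (weight_pos hm hσ).le _)
  rw [← Finset.mul_sum, Finset.sum_sub_distrib, ← Finset.mul_sum, Finset.sum_const,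
    Finset.card_univ, Fintype.card_fin, nsmul_eq_mul]
  set Q := ∑ i, (σ i - m) ^ 2
  set q := 1 - m ^ 2
  -- Tangent line of the convex `Q ^ 2 / N` at the typical value `Q = N * q`.
  have hQ : 2 * q * Q - N * q ^ 2 ≤ Q ^ 2 / N := by
    rw [le_div_iff₀ hN']
    nlinarith [sq_nonneg (Q - N * q)]
  have hneg : (s ^ 2 - s) * β ^ 2 / 4 ≤ 0 := by
    have : s ^ 2 - s ≤ 0 := by nlinarith
    have := mul_nonpos_of_nonpos_of_nonneg this (sq_nonneg β)
    linarith
  calc (s ^ 2 - s) * (β ^ 2 / (4 * (N : ℝ))) * Q ^ 2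
      = (s ^ 2 - s) * β ^ 2 / 4 * (Q ^ 2 / N) := by field_simp
    _ ≤ _ := mul_le_mul_of_nonpos_left hQ hneg

/-- Jensen in pointwise form: the tangent to `log` at `a`, later taken to be the bound on the mean.
-/
lemma mul_log_partitionFunction_le (β : ℝ) {m s a : ℝ} (hm : |m| < 1) (hs : 0 < s) (hs1 : s ≤ 1)
    (ha : 0 < a) (g : Fin N × Fin N → ℝ) :
    s * Real.log (partitionFunction N β m g) ≤ fractionalSum N β m s g / a - 1 + Real.log a := by
  have hZ := partitionFunction_pos β hm g
  have hZs := Real.rpow_pos_of_pos hZ s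
  have h1 := Real.log_le_sub_one_of_pos (div_pos hZs ha)
  rw [Real.log_div hZs.ne' ha.ne', Real.log_rpow hZ] at h1
  have h2 := div_le_div_of_nonneg_right (partitionFunction_rpow_le β hm hs hs1 g) ha.le
  linarith

lemma integrable_log_partitionFunction (β : ℝ) {m : ℝ} (hm : |m| < 1) :
    Integrable (fun g => Real.log (partitionFunction N β m g)) (couplingLaw N) := by
  have hmeas : Measurable fun g => Real.log (partitionFunction N β m g) := by
    unfold partitionFunction hamiltonian
    fun_prop
  -- Below, a single configuration; above, the linear bound with `s = a = 1`.
  refine integrable_of_le_of_le hmeas.aestronglyMeasurable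
    (g₁ := fun g => Real.log (weight N m fun _ => 1) + hamiltonian N β m g fun _ => 1)
    (g₂ := fun g => fractionalSum N β m 1 g / 1 - 1 + Real.log 1)
    (.of_forall fun g => ?_) (.of_forall fun g => ?_) ?_ ?_
  · have hw := weight_pos hm (one_mem_configs (N := N))
    have hle : weight N m (fun _ => 1) * Real.exp (hamiltonian N β m g fun _ => 1) ≤
        partitionFunction N β m g :=
      Finset.single_le_sum
        (f := fun σ => weight N m σ * Real.exp (hamiltonian N β m g σ))
        (fun σ hσ => (mul_pos (weight_pos hm hσ) (Real.exp_pos _)).le) one_mem_configs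
    have := Real.log_le_log (mul_pos hw (Real.exp_pos _)) hle
    rwa [Real.log_mul hw.ne' (Real.exp_pos _).ne', Real.log_exp] at this
  · simpa using mul_log_partitionFunction_le β hm one_pos le_rfl one_pos g
  · exact (integrable_const _).add (integrable_hamiltonian β m _)
  · exact (((integrable_fractionalSum β m 1).div_const _).sub (integrable_const _)).add
      (integrable_const _)

lemma freeEnergy_le (hN : 0 < N) (β : ℝ) {m s : ℝ} (hm : |m| < 1) (hs : 0 < s) (hs1 : s ≤ 1) :
    freeEnergy N β m ≤ Real.log (siteMoment β m s) / s := by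
  have hN' : (0 : ℝ) < N := Nat.cast_pos.2 hN
  have ha := pow_pos (siteMoment_pos β hm s) N
  set a := siteMoment β m s ^ N with ha_def
  have hint : Integrable (fun g => fractionalSum N β m s g / a - 1) (couplingLaw N) :=
    ((integrable_fractionalSum β m s).div_const _).sub (integrable_const _)
  have h1 : s * ∫ g, Real.log (partitionFunction N β m g) ∂(couplingLaw N) ≤ Real.log a := by
    rw [← integral_const_mul]
    refine (integral_mono ((integrable_log_partitionFunction β hm).const_mul s)
      (hint.add (integrable_const (Real.log a)))
      (mul_log_partitionFunction_le β hm hs hs1 ha)).trans ?_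
    simp only [Pi.add_apply]
    rw [integral_add hint (integrable_const _),
      integral_sub ((integrable_fractionalSum β m s).div_const _) (integrable_const _),
      integral_div]
    have := div_le_one_of_le₀ (integral_fractionalSum_le hN β hm hs hs1) ha.le
    simp only [integral_const, probReal_univ, one_smul]
    linarith
  rw [ha_def, Real.log_pow] at h1
  rw [freeEnergy, integral_const_mul, le_div_iff₀ hs, one_div, inv_mul_eq_div, div_mul_eq_mul_div,
    div_le_iff₀ hN']
  linarith

end PartitionFunction

/-! ### Strictly negative free energy. -/

lemma exists_freeEnergy_le_neg {β m : ℝ} (hm : |m| < 1)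
    (h : 4 * spinEntropy m < β ^ 2 * (1 - m ^ 2) ^ 2) :
    ∃ C < 0, ∀ N : ℕ, 0 < N → freeEnergy N β m ≤ C := by
  obtain ⟨s, hs, hs1, hlt⟩ := exists_siteMoment_lt_one hm h
  exact ⟨_, div_neg_of_neg_of_pos (Real.log_neg (siteMoment_pos β hm s) hlt) hs,
    fun N hN => freeEnergy_le hN β hm hs hs1.le⟩

lemma limsup_freeEnergy_neg {β m : ℝ} (hm : |m| < 1)
    (h : 4 * spinEntropy m < β ^ 2 * (1 - m ^ 2) ^ 2) :
    limsup (fun N : ℕ => (freeEnergy N β m : EReal)) atTop < 0 := by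
  obtain ⟨C, hC, hle⟩ := exists_freeEnergy_le_neg hm h
  refine lt_of_le_of_lt (limsup_le_of_le (by isBoundedDefault) (a := (C : EReal)) ?_)
    (by exact_mod_cast hC)
  -- `N = 0` is excluded: there the free energy is `0`, by `1 / 0 = 0`.
  filter_upwards [eventually_gt_atTop 0] with N hN
  exact_mod_cast hle N hN

lemma notMem_HT {β m : ℝ} (hm : |m| < 1)
    (h : 4 * spinEntropy m < β ^ 2 * (1 - m ^ 2) ^ 2) : β ∉ HT m := by
  rintro ⟨-, hlim⟩
  obtain ⟨C, hC, hle⟩ := exists_freeEnergy_le_neg hm h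
  refine absurd (le_of_tendsto hlim ?_) (not_le.2 hC)
  filter_upwards [eventually_gt_atTop 0] with N hN using hle N hN

end ToySK

theorem theorem1 :
    (∃! mstar : ℝ, 0 < mstar ∧ mstar < 1 ∧ ToySK.spinEntropy mstar = 1 / 4) ∧
    ∀ mstar : ℝ, 0 < mstar → mstar < 1 → ToySK.spinEntropy mstar = 1 / 4 →
      ∀ m : ℝ, mstar < |m| → |m| < 1 →
        (∃ β ∈ ToySK.AT m, β ∉ ToySK.HT m ∧
          limsup (fun N : ℕ => (ToySK.freeEnergy N β m : EReal)) atTop < 0) ∧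
        ¬ ToySK.AT m ⊆ ToySK.HT m ∧
        (∀ β : ℝ, 0 ≤ β → 4 * ToySK.spinEntropy m < β ^ 2 * (1 - m ^ 2) ^ 2 →
          β ^ 2 * (1 - m ^ 2) ^ 2 ≤ 1 →
            β ∉ ToySK.HT m ∧
            limsup (fun N : ℕ => (ToySK.freeEnergy N β m : EReal)) atTop < 0) := by
  refine ⟨ToySK.existsUnique_spinEntropy_eq, fun mstar h0 h1 hI m hm hm1 => ?_⟩
  have hq : 0 < 1 - m ^ 2 := by
    have := (sq_lt_one_iff_abs_lt_one m).2 hm1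
    linarith
  -- The witness `β = (1 - m ^ 2)⁻¹` lies on the boundary of `AT m`, where the criterion reads `4 *
  -- spinEntropy m < 1`.
  have hβ : ((1 - m ^ 2)⁻¹) ^ 2 * (1 - m ^ 2) ^ 2 = 1 := by
    rw [← mul_pow, inv_mul_cancel₀ hq.ne', one_pow]
  have hIm : ToySK.spinEntropy m < 1 / 4 := by
    rw [← ToySK.spinEntropy_abs, ← hI]
    exact ToySK.spinEntropy_strictAntiOn ⟨h0.le, h1.le⟩ ⟨abs_nonneg m, hm1.le⟩ hm
  have hAT : (1 - m ^ 2)⁻¹ ∈ ToySK.AT m := ⟨(inv_pos.2 hq).le, hβ.le⟩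
  have hlt : 4 * ToySK.spinEntropy m < ((1 - m ^ 2)⁻¹) ^ 2 * (1 - m ^ 2) ^ 2 := by
    rw [hβ]; linarith
  exact ⟨⟨_, hAT, ToySK.notMem_HT hm1 hlt, ToySK.limsup_freeEnergy_neg hm1 hlt⟩,
    fun hsub => ToySK.notMem_HT hm1 hlt (hsub hAT),
    fun β _ h _ => ⟨ToySK.notMem_HT hm1 h, ToySK.limsup_freeEnergy_neg hm1 h⟩⟩
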